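/- Let $-1<\rho<1$, $\theta\in\mathbb{R}$, $R=\begin{pmatrix}1&\rho\\ \rho&1\end{pmatrix}$, and let $\mathbf X=(X_1,X_2)^T$ have the bivariate skew normal distribution $SN_2(\boldsymbol\theta,R)$ with equal skewness $\boldsymbol\theta=(\theta,\theta)^T$; that is, $\mathbf X$ has density $f(\mathbf x)=2\,\phi_2(\mathbf x,R)\,\Phi(\theta x_1+\theta x_2)$ on $\mathbb{R}^2$, where $\phi_2(\cdot,R)$ is the density of the bivariate normal distribution with mean $\mathbf 0$ and correlation matrix $R$, and $\Phi$ is the standard normal cdf. Let $F_i$ be the cdf of $X_i$, $F_i^{-1}(u)=\inf\{x: F_i(x)\ge u\}$ its quantile function, $C(u_1,u_2)=P(X_1\le F_1^{-1}(u_1),X_2\le F_2^{-1}(u_2))$ the copula of $\mathbf X$, and $$\lambda_L(u)=P\bigl(X_1\le F_1^{-1}(u)\,\big|\,X_2\le F_2^{-1}(u)\bigr)=\frac{C(u,u)}{u},\qquad 0<u<1,$$ the lower tail dependence function. Put $$\lambda=\frac{\theta(1+\rho)}{\sqrt{1+\theta^2(1-\rho^2)}},\qquad \alpha=\frac{\theta(1+\rho)}{\sqrt{1+2\theta^2(1+\rho)}},\qquad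 \beta=\sqrt{\frac{(1-\rho)(1+2\theta^2(1+\rho))}{1+\rho}}.$$ Then, as $u\to0^+$ (where $f\sim g$ means $f/g\to1$): (a) if $\theta>0$, $$\lambda_L(u)\sim u^{\beta^2}\,\frac{\alpha^3}{\pi\lambda^4\beta(1+\beta^2)^2}\sqrt{\frac{2}{\pi}}\,(2\pi\lambda)^{1+\beta^2}\left(\frac{1+\lambda^2}{2}\right)^{3/2}(-\log u)^{\beta^2-\frac12};$$ (b) if $\theta<0$, $$\lambda_L(u)\sim u^{\frac{1-\rho}{1+\rho}}\cdot\frac{1+\rho}{2}\sqrt{\frac{1+\rho}{1-\rho}}\,(-\pi\log u)^{-\frac{\rho}{1+\rho}}.$$ -/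

import Mathlib

open MeasureTheory ProbabilityTheory Filter Asymptotics
open scoped Topology Matrix

noncomputable section

namespace SkewNormal

/-- The correlation matrix with off-diagonal entry `ρ`. -/
def corrMatrix (ρ : ℝ) : Matrix (Fin 2) (Fin 2) ℝ := !![1, ρ; ρ, 1]

/-- The Lebesgue density `φ₂(x, R)` of the centred bivariate normal distribution with
covariance matrix `R`. -/
def normalPDF₂ (R : Matrix (Fin 2) (Fin 2) ℝ) (x : Fin 2 → ℝ) : ℝ :=
  (2 * Real.pi * √R.det)⁻¹ * Real.exp (-(x ⬝ᵥ (R⁻¹ *ᵥ x)) / 2)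

/-- The cdf `Φ` of the univariate standard normal distribution. -/
def stdNormalCDF (z : ℝ) : ℝ := cdf (gaussianReal 0 1) z

/-- The density `2 φ₂(x, R) Φ(θᵀ x)`. -/
def skewNormalPDF₂ (θ : Fin 2 → ℝ) (R : Matrix (Fin 2) (Fin 2) ℝ) (x : Fin 2 → ℝ) : ℝ :=
  2 * normalPDF₂ R x * stdNormalCDF (θ ⬝ᵥ x)

/-- The bivariate skew normal distribution `SN₂(θ, R)`. -/
def skewNormal₂ (θ : Fin 2 → ℝ) (R : Matrix (Fin 2) (Fin 2) ℝ) : Measure (Fin 2 → ℝ) :=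
  volume.withDensity fun x => ENNReal.ofReal (skewNormalPDF₂ θ R x)

section TailDependence

variable {Ω : Type*} [MeasurableSpace Ω]

/-- The distribution function `F_i` of the `i`-th component of `X`. -/
def marginalCDF (P : Measure Ω) (X : Ω → Fin 2 → ℝ) (i : Fin 2) (x : ℝ) : ℝ :=
  P.real {ω | X ω i ≤ x}

/-- The quantile function `F_i⁻¹(u) = inf {x : F_i(x) ≥ u}`, for `0 < u < 1`. -/
def quantile (P : Measure Ω) (X : Ω → Fin 2 → ℝ) (i : Fin 2) (u : ℝ) : ℝ :=
  sInf {x : ℝ | u ≤ marginalCDF P X i x}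

/-- The copula `C(u₁, u₂) = P(X₁ ≤ F₁⁻¹(u₁), X₂ ≤ F₂⁻¹(u₂))` of `X`, for `0 < u₁, u₂ < 1`. -/
def copula (P : Measure Ω) (X : Ω → Fin 2 → ℝ) (u₁ u₂ : ℝ) : ℝ :=
  P.real {ω | X ω 0 ≤ quantile P X 0 u₁ ∧ X ω 1 ≤ quantile P X 1 u₂}

/-- The lower tail dependence function
`λ_L(u) = P(X₁ ≤ F₁⁻¹(u) | X₂ ≤ F₂⁻¹(u))`, for `0 < u < 1`. -/
def lowerTailDependence (P : Measure Ω) (X : Ω → Fin 2 → ℝ) (u : ℝ) : ℝ :=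
  (P[|{ω | X ω 1 ≤ quantile P X 1 u}]).real {ω | X ω 0 ≤ quantile P X 0 u}

end TailDependence

/-- The constant `λ`. -/
def lam (θ ρ : ℝ) : ℝ := θ * (1 + ρ) / √(1 + θ ^ 2 * (1 - ρ ^ 2))

/-- The constant `α`. -/
def alpha (θ ρ : ℝ) : ℝ := θ * (1 + ρ) / √(1 + 2 * θ ^ 2 * (1 + ρ))

/-- The constant `β`. -/
def beta (θ ρ : ℝ) : ℝ := √((1 - ρ) * (1 + 2 * θ ^ 2 * (1 + ρ)) / (1 + ρ))

end SkewNormal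

end

/-! The Laplace method gives lower tails `c t^(-p) exp (-a t²)` at `-t` for the marginal and the
joint distribution function. An integral of `exp (-xᵀ A x / 2) H (w ⬝ x)` over the orthant
`{x ≤ -t e}` concentrates within distance `1 / t` of the corner `-t e`: after the substitution
`x = -t e - y / t` the exponent becomes linear in `y` up to `O(1 / t²)`, and the integral factors
into exponential ones. With `H = Φ (k ·)` the factor contributes a Gaussian tail of its own if
`k > 0`, and tends to `1` if `k < 0`; this is the difference between the two signs of `θ`. The
marginals are univariate skew normal with skewness `λ`. Since they are equal, `C(u, u)` is the joint
distribution function at `(x, x)`, where `x = F₁⁻¹(u)`, and eliminating `x` between the two tails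
expresses `C(u, u)` by `u` and `-log u`. -/

namespace SkewNormal

section Rescaling

variable {E : Type*} [NormedAddCommGroup E] [NormedSpace ℝ E] [FiniteDimensional ℝ E]
  [MeasurableSpace E] [BorelSpace E] [PartialOrder E] [IsOrderedAddMonoid E] [PosSMulMono ℝ E]

open scoped Pointwise in
theorem setIntegral_Ici_zero_comp_rescale (μ : Measure E) [μ.IsAddHaarMeasure] (f : E → ℝ) (c : E)
    {t : ℝ} (ht : 0 < t) :
    ∫ x in Set.Ici 0, f (c - t⁻¹ • x) ∂μ =
      t ^ Module.finrank ℝ E * ∫ y in Set.Iic c, f y ∂μ := by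
  have hcone : t⁻¹ • Set.Ici (0 : E) = Set.Ici 0 := by
    ext x
    rw [Set.mem_inv_smul_set_iff₀ ht.ne', Set.mem_Ici, Set.mem_Ici]
    refine ⟨fun h => ?_, smul_nonneg ht.le⟩
    simpa only [inv_smul_smul₀ ht.ne'] using smul_nonneg (inv_nonneg.2 ht.le) h
  have hreflect : ∫ y in Set.Ici 0, f (c - y) ∂μ = ∫ y in Set.Iic c, f y ∂μ := by
    have hpre : (fun y => c - y) ⁻¹' Set.Iic c = Set.Ici 0 := by simp
    rw [← hpre]
    exact (Measure.measurePreserving_sub_left μ c).setIntegral_preimage_emb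
      (MeasurableEquiv.subLeft c).measurableEmbedding f _
  rw [Measure.setIntegral_comp_smul_of_pos μ (fun y => f (c - y)) _ (inv_pos.2 ht), hcone,
    hreflect, inv_pow, inv_inv, smul_eq_mul]

end Rescaling

section Orthant

variable {ι : Type*} [Fintype ι] {v : ι → ℝ}

theorem volume_restrict_Ici (a : ι → ℝ) :
    (volume : Measure (ι → ℝ)).restrict (Set.Ici a) =
      Measure.pi fun i => volume.restrict (Set.Ici (a i)) := by
  rw [volume_pi, ← Set.pi_univ_Ici, Measure.restrict_pi_pi]

theorem exp_neg_dotProduct (v x : ι → ℝ) :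
    Real.exp (-(v ⬝ᵥ x)) = ∏ i, Real.exp (-v i * x i) := by
  rw [← Real.exp_sum, dotProduct, ← Finset.sum_neg_distrib]
  simp only [neg_mul]

theorem integrableOn_Ici_exp_neg_dotProduct (hv : ∀ i, 0 < v i) :
    IntegrableOn (fun x => Real.exp (-(v ⬝ᵥ x))) (Set.Ici 0) := by
  simp only [IntegrableOn, volume_restrict_Ici, exp_neg_dotProduct]
  exact Integrable.fintype_prod fun i =>
    (integrableOn_Ici_iff_integrableOn_Ioi).2 (exp_neg_integrableOn_Ioi 0 (hv i))

theorem setIntegral_Ici_exp_neg_dotProduct (hv : ∀ i, 0 < v i) :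
    ∫ x in Set.Ici 0, Real.exp (-(v ⬝ᵥ x)) = ∏ i, (v i)⁻¹ := by
  simp only [volume_restrict_Ici, exp_neg_dotProduct]
  rw [integral_fintype_prod_eq_prod fun i x => Real.exp (-v i * x)]
  refine Finset.prod_congr rfl fun i _ => ?_
  rw [Pi.zero_apply, integral_Ici_eq_integral_Ioi, integral_exp_mul_Ioi (neg_neg_of_pos (hv i))]
  simp [neg_div_neg_eq]

end Orthant

/-- `F` has a lower tail of Gaussian type: for `c ≠ 0` this says
`F (-t) ~ c * t ^ (-p) * exp (-a * t ^ 2)` as `t → ∞`. The values `p = a = 0` describe a function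
with limit `c` at `-∞`. -/
def HasGaussianTail (F : ℝ → ℝ) (c p a : ℝ) : Prop :=
  Tendsto (fun t => F (-t) * t ^ p * Real.exp (a * t ^ 2)) atTop (𝓝 c)

namespace HasGaussianTail

variable {F G : ℝ → ℝ} {c p a : ℝ}

theorem const_mul (h : HasGaussianTail F c p a) (k : ℝ) :
    HasGaussianTail (fun s => k * F s) (k * c) p a := by
  simpa only [HasGaussianTail, mul_assoc] using Tendsto.const_mul k h

theorem comp_mul_left (h : HasGaussianTail F c p a) {k : ℝ} (hk : 0 < k) :
    HasGaussianTail (fun s => F (k * s)) (k ^ (-p) * c) p (a * k ^ 2) := by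
  have hlim := (h.comp (tendsto_id.const_mul_atTop hk)).const_mul (k ^ (-p))
  refine hlim.congr' ((eventually_ge_atTop 0).mono fun t ht => ?_)
  simp only [Function.comp, id, mul_neg, Real.mul_rpow hk.le ht, Real.rpow_neg hk.le, mul_pow]
  field_simp

theorem eventually_pos (h : HasGaussianTail F c p a) (hc : 0 < c) : ∀ᶠ t in atTop, 0 < F (-t) := by
  filter_upwards [h.eventually (lt_mem_nhds hc), eventually_gt_atTop 0] with t hpos ht
  rwa [mul_pos_iff_of_pos_right (Real.exp_pos _),
    mul_pos_iff_of_pos_right (Real.rpow_pos_of_pos ht p)] at hpos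

theorem rpow (h : HasGaussianTail F c p a) (hc : 0 < c) (k : ℝ) :
    HasGaussianTail (fun s => F s ^ k) (c ^ k) (p * k) (a * k) := by
  refine (Tendsto.rpow_const h (Or.inl hc.ne')).congr' ?_
  filter_upwards [h.eventually_pos hc, eventually_gt_atTop 0] with t hF ht
  rw [Real.mul_rpow (by positivity) (by positivity), Real.mul_rpow hF.le (by positivity),
    ← Real.rpow_mul ht.le, ← Real.exp_mul, mul_right_comm a]

theorem isEquivalent (h : HasGaussianTail F c p a) (hc : c ≠ 0) :
    (fun t => F (-t)) ~[atTop] fun t => c * t ^ (-p) * Real.exp (-(a * t ^ 2)) := by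
  have hconst := (isEquivalent_const_iff_tendsto hc).2 h
  have hmul := hconst.mul (IsEquivalent.refl (u := fun t : ℝ => t ^ (-p) * Real.exp (-(a * t ^ 2))))
  refine (hmul.congr_left ?_).congr_right (.of_forall fun t => (mul_assoc _ _ _).symm)
  filter_upwards [eventually_gt_atTop 0] with t ht
  rw [Pi.mul_apply, Real.rpow_neg ht.le, Real.exp_neg]
  field_simp

theorem neg_log_isEquivalent (h : HasGaussianTail F c p a) (hc : 0 < c) (ha : 0 < a) :
    (fun t => -Real.log (F (-t))) ~[atTop] fun t => a * t ^ 2 := by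
  have hlog : Tendsto (fun t => Real.log (F (-t) * t ^ p * Real.exp (a * t ^ 2))) atTop
      (𝓝 (Real.log c)) := Tendsto.log h hc.ne'
  have hsq : Tendsto (fun t : ℝ => a * t ^ 2) atTop atTop :=
    (tendsto_pow_atTop two_ne_zero).const_mul_atTop ha
  have hconst : (fun t => Real.log (F (-t) * t ^ p * Real.exp (a * t ^ 2)))
      =o[atTop] fun t => a * t ^ 2 :=
    (hlog.isBigO_one ℝ).trans_isLittleO
      ((isLittleO_one_left_iff ℝ).2 (tendsto_norm_atTop_atTop.comp hsq))
  have hlogt : (fun t => p * Real.log t) =o[atTop] fun t => a * t ^ 2 := by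
    have := isLittleO_log_rpow_atTop (r := 2) two_pos
    simp only [Real.rpow_two] at this
    exact (this.const_mul_left p).const_mul_right ha.ne'
  refine ((IsEquivalent.refl.add_isLittleO hlogt).sub_isLittleO hconst).congr_left ?_
  filter_upwards [h.eventually_pos hc, eventually_gt_atTop 0] with t hF ht
  have htp := Real.rpow_pos_of_pos ht p
  rw [Pi.sub_apply, Pi.add_apply, Real.log_mul (by positivity) (Real.exp_ne_zero _), Real.log_exp,
    Real.log_mul hF.ne' htp.ne', Real.log_rpow ht]
  ring

/-- Comparing exponents, the rate `exp (-b * t ^ 2)` of `G` is that of `F ^ (b / a)`; the remaining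
power of `t` is then expressed through `t ^ 2 ~ -log F / a`. -/
theorem isEquivalent_rpow_mul_neg_log_rpow {d q b : ℝ} (hF : HasGaussianTail F c p a)
    (hG : HasGaussianTail G d q b) (hc : 0 < c) (hd : d ≠ 0) (ha : 0 < a) :
    (fun t => G (-t)) ~[atTop] fun t =>
      d * (F (-t) / c) ^ (b / a) * (-Real.log (F (-t)) / a) ^ ((p * (b / a) - q) / 2) := by
  set k := b / a
  have hpow : (fun t => (F (-t) / c) ^ k) ~[atTop]
      fun t => t ^ (-(p * k)) * Real.exp (-(b * t ^ 2)) := by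
    have h := (hF.const_mul c⁻¹).rpow (by positivity) k
    rw [inv_mul_cancel₀ hc.ne', Real.one_rpow, mul_div_cancel₀ b ha.ne'] at h
    simpa only [one_mul, div_eq_inv_mul] using h.isEquivalent one_ne_zero
  have hlog : (fun t => (-Real.log (F (-t)) / a) ^ ((p * k - q) / 2)) ~[atTop]
      fun t => (t ^ 2) ^ ((p * k - q) / 2) := by
    have h := (hF.neg_log_isEquivalent hc ha).div (IsEquivalent.refl (u := fun _ => a))
    refine IsEquivalent.rpow (fun t => sq_nonneg t) (h.congr_right (.of_forall fun t => ?_))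
    rw [Pi.div_apply, mul_div_cancel_left₀ _ ha.ne']
  have hrhs := ((IsEquivalent.refl (u := fun _ => d)).mul hpow).mul hlog
  refine (hG.isEquivalent hd).trans (hrhs.symm.congr_left ?_)
  filter_upwards [eventually_gt_atTop 0] with t ht
  have hexp : t ^ (-q) = t ^ (-(p * k)) * (t ^ 2) ^ ((p * k - q) / 2) := by
    rw [← Real.rpow_natCast_mul ht.le, ← Real.rpow_add ht]
    congr 1
    push_cast
    ring
  simp only [Pi.mul_apply, hexp]
  ring

theorem tendsto_rescaled (h : HasGaussianTail F c p a) (s : ℝ) :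
    Tendsto (fun t => F (-(t + t⁻¹ * s)) * t ^ p * Real.exp (a * t ^ 2)) atTop
      (𝓝 (c * Real.exp (-(2 * a * s)))) := by
  have hinv : Tendsto (fun t : ℝ => (t⁻¹) ^ 2) atTop (𝓝 0) := by
    simpa using (tendsto_inv_atTop_zero (𝕜 := ℝ)).pow 2
  have hz : Tendsto (fun t : ℝ => t + t⁻¹ * s) atTop atTop :=
    tendsto_id.atTop_add (tendsto_inv_atTop_zero.mul_const s)
  have hpow : Tendsto (fun t : ℝ => (1 + s * (t⁻¹) ^ 2) ^ (-p)) atTop (𝓝 1) := by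
    simpa using ((hinv.const_mul s).const_add 1).rpow_const (p := -p) (by simp)
  have hexp : Tendsto (fun t : ℝ => Real.exp (-(2 * a * s) - a * s ^ 2 * (t⁻¹) ^ 2)) atTop
      (𝓝 (Real.exp (-(2 * a * s)))) := by
    simpa using ((hinv.const_mul (a * s ^ 2)).const_sub (-(2 * a * s))).rexp
  have hlim := ((h.comp hz).mul hpow).mul hexp
  rw [mul_one] at hlim
  refine hlim.congr' ?_
  filter_upwards [eventually_gt_atTop 0, hz.eventually_gt_atTop 0] with t ht hz
  have hfactor : t + t⁻¹ * s = t * (1 + s * (t⁻¹) ^ 2) := by field_simp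
  have hsq : Real.exp (a * (t + t⁻¹ * s) ^ 2) *
      Real.exp (-(2 * a * s) - a * s ^ 2 * (t⁻¹) ^ 2) = Real.exp (a * t ^ 2) := by
    rw [← Real.exp_add]
    congr 1
    field_simp
    ring
  rw [hfactor] at hz
  have hz' : 0 < 1 + s * (t⁻¹) ^ 2 := (mul_pos_iff_of_pos_left ht).1 hz
  have hpow_mul : (t + t⁻¹ * s) ^ p * (1 + s * (t⁻¹) ^ 2) ^ (-p) = t ^ p := by
    rw [hfactor, Real.mul_rpow ht.le hz'.le, mul_assoc, ← Real.rpow_add hz', add_neg_cancel,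
      Real.rpow_zero, mul_one]
  rw [← hpow_mul, ← hsq, Function.comp]
  ring

theorem eventually_abs_rescaled_le (h : HasGaussianTail F c p a) (hp : 0 ≤ p) (ha : 0 ≤ a) :
    ∃ C, ∀ᶠ t in atTop, ∀ s ≥ 0,
      |F (-(t + t⁻¹ * s)) * t ^ p * Real.exp (a * t ^ 2)| ≤ C := by
  have hbound := (Tendsto.abs h).eventually (ge_mem_nhds (lt_add_one |c|))
  refine ⟨|c| + 1, ?_⟩
  filter_upwards [eventually_forall_ge_atTop.2 hbound, eventually_gt_atTop 0] with t hbound ht s hs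
  have hz : t ≤ t + t⁻¹ * s := le_add_of_nonneg_right (by positivity)
  refine le_trans ?_ (hbound _ hz)
  simp only [abs_mul, Real.abs_exp, abs_of_nonneg (Real.rpow_nonneg ht.le p),
    abs_of_nonneg (Real.rpow_nonneg (ht.le.trans hz) p)]
  gcongr

end HasGaussianTail

section Laplace

variable {ι : Type*} [Fintype ι] {A : Matrix ι ι ℝ} {e w : ι → ℝ} {H : ℝ → ℝ} {c p a t : ℝ}

theorem dotProduct_mulVec_rescale (hA : A.IsSymm) (ht : t ≠ 0) (e x : ι → ℝ) :
    (-t • e - t⁻¹ • x) ⬝ᵥ (A *ᵥ (-t • e - t⁻¹ • x)) =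
      t ^ 2 * (e ⬝ᵥ (A *ᵥ e)) + 2 * ((A *ᵥ e) ⬝ᵥ x) + (t⁻¹) ^ 2 * (x ⬝ᵥ (A *ᵥ x)) := by
  have hsymm : e ⬝ᵥ (A *ᵥ x) = (A *ᵥ e) ⬝ᵥ x := by
    rw [Matrix.dotProduct_mulVec, ← Matrix.mulVec_transpose, hA]
  simp only [Matrix.mulVec_sub, Matrix.mulVec_smul, dotProduct_sub, sub_dotProduct,
    dotProduct_smul, smul_dotProduct, smul_eq_mul, hsymm, dotProduct_comm x (A *ᵥ e)]
  field_simp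
  ring

theorem gaussian_mul_rescale (hA : A.IsSymm) (hw : w ⬝ᵥ e = 1) (ht : t ≠ 0) (H : ℝ → ℝ) (a p : ℝ)
    (x : ι → ℝ) :
    Real.exp (-((-t • e - t⁻¹ • x) ⬝ᵥ (A *ᵥ (-t • e - t⁻¹ • x))) / 2) *
        H (w ⬝ᵥ (-t • e - t⁻¹ • x)) * t ^ p * Real.exp ((e ⬝ᵥ (A *ᵥ e) / 2 + a) * t ^ 2) =
      Real.exp (-((A *ᵥ e) ⬝ᵥ x)) * Real.exp (-((t⁻¹) ^ 2 * (x ⬝ᵥ (A *ᵥ x) / 2))) *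
        (H (-(t + t⁻¹ * (w ⬝ᵥ x))) * t ^ p * Real.exp (a * t ^ 2)) := by
  have hlin : w ⬝ᵥ (-t • e - t⁻¹ • x) = -(t + t⁻¹ * (w ⬝ᵥ x)) := by
    simp only [dotProduct_sub, dotProduct_smul, smul_eq_mul, hw]
    ring
  have hexp : Real.exp (-((-t • e - t⁻¹ • x) ⬝ᵥ (A *ᵥ (-t • e - t⁻¹ • x))) / 2) *
      Real.exp ((e ⬝ᵥ (A *ᵥ e) / 2 + a) * t ^ 2) =
      Real.exp (-((A *ᵥ e) ⬝ᵥ x)) * Real.exp (-((t⁻¹) ^ 2 * (x ⬝ᵥ (A *ᵥ x) / 2))) *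
        Real.exp (a * t ^ 2) := by
    simp only [dotProduct_mulVec_rescale hA ht, ← Real.exp_add]
    congr 1
    ring
  rw [hlin]
  linear_combination (H (-(t + t⁻¹ * (w ⬝ᵥ x))) * t ^ p) * hexp

theorem HasGaussianTail.exists_bound_gaussian_mul_rescale (hH : HasGaussianTail H c p a)
    (hp : 0 ≤ p) (ha : 0 ≤ a) (hA : A.PosSemidef) (hw : 0 ≤ w) (hwe : w ⬝ᵥ e = 1) :
    ∃ C, ∀ᶠ t in atTop, ∀ x ∈ Set.Ici (0 : ι → ℝ),
      ‖Real.exp (-((-t • e - t⁻¹ • x) ⬝ᵥ (A *ᵥ (-t • e - t⁻¹ • x))) / 2) *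
        H (w ⬝ᵥ (-t • e - t⁻¹ • x)) * t ^ p * Real.exp ((e ⬝ᵥ (A *ᵥ e) / 2 + a) * t ^ 2)‖ ≤
      Real.exp (-((A *ᵥ e) ⬝ᵥ x)) * C := by
  obtain ⟨C, hC⟩ := hH.eventually_abs_rescaled_le hp ha
  refine ⟨C, ?_⟩
  filter_upwards [hC, eventually_gt_atTop 0] with t hC ht x hx
  have hquad : 0 ≤ x ⬝ᵥ (A *ᵥ x) := hA.dotProduct_mulVec_nonneg x
  have hdamp : Real.exp (-((t⁻¹) ^ 2 * (x ⬝ᵥ (A *ᵥ x) / 2))) ≤ 1 :=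
    Real.exp_le_one_iff.2 (neg_nonpos.2 (by positivity))
  have hsymm : A.IsSymm := Matrix.isHermitian_iff_isSymm.1 hA.isHermitian
  rw [gaussian_mul_rescale hsymm hwe ht.ne' H a p x, norm_mul, norm_mul,
    Real.norm_of_nonneg (Real.exp_pos _).le, Real.norm_of_nonneg (Real.exp_pos _).le,
    Real.norm_eq_abs]
  exact mul_le_mul (mul_le_of_le_one_right (Real.exp_pos _).le hdamp)
    (hC _ (dotProduct_nonneg_of_nonneg hw hx)) (abs_nonneg _) (Real.exp_pos _).le

theorem HasGaussianTail.tendsto_gaussian_mul_rescale (hH : HasGaussianTail H c p a)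
    (hA : A.IsSymm) (hwe : w ⬝ᵥ e = 1) (x : ι → ℝ) :
    Tendsto (fun t => Real.exp (-((-t • e - t⁻¹ • x) ⬝ᵥ (A *ᵥ (-t • e - t⁻¹ • x))) / 2) *
        H (w ⬝ᵥ (-t • e - t⁻¹ • x)) * t ^ p * Real.exp ((e ⬝ᵥ (A *ᵥ e) / 2 + a) * t ^ 2)) atTop
      (𝓝 (c * Real.exp (-((A *ᵥ e + (2 * a) • w) ⬝ᵥ x)))) := by
  have hdamp : Tendsto (fun t : ℝ => Real.exp (-((t⁻¹) ^ 2 * (x ⬝ᵥ (A *ᵥ x) / 2)))) atTop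
      (𝓝 1) := by
    simpa using ((tendsto_inv_atTop_zero.pow 2).mul_const (x ⬝ᵥ (A *ᵥ x) / 2)).neg.rexp
  have hlim := (hdamp.const_mul (Real.exp (-((A *ᵥ e) ⬝ᵥ x)))).mul
    (hH.tendsto_rescaled (w ⬝ᵥ x))
  have hval : Real.exp (-((A *ᵥ e) ⬝ᵥ x)) * 1 * (c * Real.exp (-(2 * a * (w ⬝ᵥ x)))) =
      c * Real.exp (-((A *ᵥ e + (2 * a) • w) ⬝ᵥ x)) := by
    rw [add_dotProduct, smul_dotProduct, smul_eq_mul, neg_add, Real.exp_add]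
    ring
  rw [hval] at hlim
  refine hlim.congr' ((eventually_ne_atTop 0).mono fun t ht => ?_)
  exact (gaussian_mul_rescale hA hwe ht H a p x).symm

theorem HasGaussianTail.setIntegral_Iic_smul (hH : HasGaussianTail H c p a)
    (hHm : Measurable H) (hp : 0 ≤ p) (ha : 0 ≤ a) (hA : A.PosSemidef)
    (hAe : ∀ i, 0 < (A *ᵥ e) i) (hw : 0 ≤ w) (hwe : w ⬝ᵥ e = 1) :
    HasGaussianTail
      (fun s => ∫ x in Set.Iic (s • e), Real.exp (-(x ⬝ᵥ (A *ᵥ x)) / 2) * H (w ⬝ᵥ x))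
      (c * ∏ i, ((A *ᵥ e) i + 2 * a * w i)⁻¹) (p + Fintype.card ι) (e ⬝ᵥ (A *ᵥ e) / 2 + a) := by
  have hsymm : A.IsSymm := Matrix.isHermitian_iff_isSymm.1 hA.isHermitian
  obtain ⟨C, hC⟩ := hH.exists_bound_gaussian_mul_rescale hp ha hA hw hwe
  have hrate : ∀ i, 0 < (A *ᵥ e + (2 * a) • w) i := fun i =>
    add_pos_of_pos_of_nonneg (hAe i) (mul_nonneg (by positivity) (hw i))
  have hlim := tendsto_integral_filter_of_dominated_convergence
    (μ := volume.restrict (Set.Ici (0 : ι → ℝ))) (fun x => Real.exp (-((A *ᵥ e) ⬝ᵥ x)) * C)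
    (.of_forall fun t => (by fun_prop : Measurable _).aestronglyMeasurable)
    (hC.mono fun t ht => ae_restrict_of_forall_mem measurableSet_Ici ht)
    ((integrableOn_Ici_exp_neg_dotProduct hAe).mul_const C)
    (.of_forall fun x => hH.tendsto_gaussian_mul_rescale hsymm hwe x)
  rw [integral_const_mul, setIntegral_Ici_exp_neg_dotProduct hrate] at hlim
  refine hlim.congr' ((eventually_gt_atTop 0).mono fun t ht => ?_)
  simp only [integral_mul_const]
  rw [setIntegral_Ici_zero_comp_rescale volume
    (fun x => Real.exp (-(x ⬝ᵥ (A *ᵥ x)) / 2) * H (w ⬝ᵥ x)) (-t • e) ht,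
    Module.finrank_fintype_fun_eq_card, Real.rpow_add_natCast ht.ne']
  ring

theorem HasGaussianTail.setIntegral_Iic (hH : HasGaussianTail H c p a) (hHm : Measurable H)
    (hp : 0 ≤ p) (ha : 0 ≤ a) :
    HasGaussianTail (fun s => ∫ x in Set.Iic s, Real.exp (-x ^ 2 / 2) * H x)
      (c / (1 + 2 * a)) (p + 1) (1 / 2 + a) := by
  have h := hH.setIntegral_Iic_smul (A := (1 : Matrix Unit Unit ℝ)) (e := 1) (w := 1) hHm hp ha
    Matrix.PosSemidef.one (by simp) zero_le_one (by simp)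
  convert h using 1
  · ext s
    rw [← (volume_preserving_funUnique Unit ℝ).setIntegral_preimage_emb
      (MeasurableEquiv.funUnique Unit ℝ).measurableEmbedding]
    have hpre : MeasurableEquiv.funUnique Unit ℝ ⁻¹' Set.Iic s = Set.Iic (s • 1) :=
      Set.ext fun x => ⟨fun h _ => by simpa using h, fun h => by simpa using h ()⟩
    rw [hpre]
    simp [sq]
  all_goals simp [div_eq_mul_inv]

end Laplace

section StdNormalCDF

theorem stdNormalCDF_nonneg (z : ℝ) : 0 ≤ stdNormalCDF z := cdf_nonneg _ z

@[fun_prop]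
theorem measurable_stdNormalCDF : Measurable stdNormalCDF := (monotone_cdf _).measurable

theorem ofReal_stdNormalCDF (z : ℝ) :
    ENNReal.ofReal (stdNormalCDF z) = gaussianReal 0 1 (Set.Iic z) := ofReal_cdf _ z

theorem gaussianPDFReal_zero_one (x : ℝ) :
    gaussianPDFReal 0 1 x = (√(2 * Real.pi))⁻¹ * Real.exp (-x ^ 2 / 2) := by
  simp [gaussianPDFReal]

theorem stdNormalCDF_eq_setIntegral (z : ℝ) :
    stdNormalCDF z = (√(2 * Real.pi))⁻¹ * ∫ x in Set.Iic z, Real.exp (-x ^ 2 / 2) := by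
  rw [stdNormalCDF, cdf_eq_real, Measure.real, gaussianReal_apply_eq_integral 0 one_ne_zero,
    ENNReal.toReal_ofReal (integral_nonneg fun x => gaussianPDFReal_nonneg _ _ _)]
  simp only [gaussianPDFReal_zero_one, integral_const_mul]

theorem hasGaussianTail_stdNormalCDF :
    HasGaussianTail stdNormalCDF (√(2 * Real.pi))⁻¹ 1 (1 / 2) := by
  have hone : HasGaussianTail (fun _ => 1) 1 0 0 := by simp [HasGaussianTail]
  rw [funext stdNormalCDF_eq_setIntegral]
  simpa using (hone.setIntegral_Iic measurable_const le_rfl le_rfl).const_mul (√(2 * Real.pi))⁻¹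

theorem hasGaussianTail_stdNormalCDF_mul_of_pos {k : ℝ} (hk : 0 < k) :
    HasGaussianTail (fun s => stdNormalCDF (k * s)) (√(2 * Real.pi) * k)⁻¹ 1 (k ^ 2 / 2) := by
  have h := hasGaussianTail_stdNormalCDF.comp_mul_left hk
  rwa [Real.rpow_neg_one, ← mul_inv_rev, one_div_mul_eq_div] at h

theorem hasGaussianTail_stdNormalCDF_mul_of_neg {k : ℝ} (hk : k < 0) :
    HasGaussianTail (fun s => stdNormalCDF (k * s)) 1 0 0 := by
  have hlim : Tendsto (fun t => stdNormalCDF (-k * t)) atTop (𝓝 1) :=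
    (tendsto_cdf_atTop _).comp (tendsto_id.const_mul_atTop (neg_pos.2 hk))
  simpa [HasGaussianTail] using hlim

theorem gaussianReal_Iic (μ : ℝ) {v : NNReal} (hv : v ≠ 0) (s : ℝ) :
    gaussianReal μ v (Set.Iic s) = ENNReal.ofReal (stdNormalCDF ((s - μ) / √v)) := by
  have hmap : (gaussianReal 0 1).map (fun x => √v * x + μ) = gaussianReal μ v := by
    have h := gaussianReal_map_add_const (μ := √v * 0) (v := .mk (√v ^ 2) (sq_nonneg _) * 1) μ
    rw [← gaussianReal_map_const_mul, Measure.map_map (by fun_prop) (by fun_prop)] at h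
    have hvar : NNReal.mk (√v ^ 2) (sq_nonneg _) * 1 = v := by
      ext
      simp
    rwa [mul_zero, zero_add, hvar] at h
  have hpre : (fun x => √v * x + μ) ⁻¹' Set.Iic s = Set.Iic ((s - μ) / √v) := by
    ext x
    rw [Set.mem_preimage, Set.mem_Iic, Set.mem_Iic, le_div_iff₀' (by positivity),
      le_sub_iff_add_le]
  rw [← hmap, Measure.map_apply (by fun_prop) measurableSet_Iic, hpre, ofReal_stdNormalCDF]

theorem conv_gaussianReal_Iic (ν : Measure ℝ) [SFinite ν] (a : ℝ) :
    (ν ∗ gaussianReal 0 1) (Set.Iic a) = ∫⁻ y, ENNReal.ofReal (stdNormalCDF (a - y)) ∂ν := by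
  rw [← lintegral_indicator_one measurableSet_Iic,
    Measure.lintegral_conv (measurable_one.indicator measurableSet_Iic)]
  refine lintegral_congr fun y => ?_
  rw [ofReal_stdNormalCDF, ← Set.preimage_const_add_Iic,
    ← lintegral_indicator_one (measurable_const_add y measurableSet_Iic)]
  rfl

theorem lintegral_stdNormalCDF_gaussianReal (a b μ : ℝ) (v : NNReal) :
    ∫⁻ y, ENNReal.ofReal (stdNormalCDF (a + b * y)) ∂(gaussianReal μ v) =
      ENNReal.ofReal (stdNormalCDF ((a + b * μ) / √(1 + b ^ 2 * v))) := by
  have hconv : (gaussianReal μ v).map (fun y => -b * y) ∗ gaussianReal 0 1 =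
      gaussianReal (-b * μ) (.mk ((-b) ^ 2) (sq_nonneg _) * v + 1) := by
    rw [gaussianReal_map_const_mul, gaussianReal_conv_gaussianReal, add_zero]
  have hIic := congrArg (fun m => m (Set.Iic a)) hconv
  simp only [conv_gaussianReal_Iic] at hIic
  rw [lintegral_map (by fun_prop) (by fun_prop), gaussianReal_Iic _ (by positivity)] at hIic
  simpa [add_comm (1 : ℝ)] using hIic

end StdNormalCDF

section WithDensity

variable {α β γ : Type*} [MeasurableSpace α] [MeasurableSpace β] [MeasurableSpace γ]

theorem map_fst_withDensity_comp {m : Measure α} {μ : Measure β} {ν : Measure γ} [SFinite μ]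
    [SFinite ν] {e : α → β × γ} (he : MeasurePreserving e m (μ.prod ν)) {g : β × γ → ENNReal}
    (hg : Measurable g) :
    (m.withDensity (g ∘ e)).map (fun x => (e x).1) = μ.withDensity fun x => ∫⁻ y, g (x, y) ∂ν := by
  ext s hs
  have hpre : (fun x => (e x).1) ⁻¹' s = e ⁻¹' (s ×ˢ Set.univ) := by
    ext x
    simp
  have hs' : MeasurableSet (s ×ˢ (Set.univ : Set γ)) := hs.prod .univ
  rw [Measure.map_apply he.measurable.fst hs, hpre,
    withDensity_apply _ (he.measurable hs'), withDensity_apply _ hs]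
  calc ∫⁻ x in e ⁻¹' (s ×ˢ Set.univ), g (e x) ∂m
      = ∫⁻ z in s ×ˢ Set.univ, g z ∂(μ.prod ν) := he.setLIntegral_comp_preimage hs' hg
    _ = ∫⁻ x in s, ∫⁻ y, g (x, y) ∂ν ∂μ := by
      rw [← Measure.prod_restrict, Measure.restrict_univ, lintegral_prod _ hg.aemeasurable]

theorem real_withDensity_ofReal {μ : Measure α} {f : α → ℝ} (hf : Measurable f) (hf₀ : 0 ≤ f)
    {s : Set α} (hs : MeasurableSet s) :
    (μ.withDensity fun x => ENNReal.ofReal (f x)).real s = ∫ x in s, f x ∂μ := by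
  rw [Measure.real, withDensity_apply _ hs,
    integral_eq_lintegral_of_nonneg_ae (.of_forall hf₀) hf.aestronglyMeasurable]

end WithDensity

theorem volume_preserving_pair (i : Fin 2) :
    MeasurePreserving fun x : Fin 2 → ℝ => (x i, x (i + 1)) := by
  fin_cases i
  · exact volume_preserving_finTwoArrow ℝ
  · exact Measure.measurePreserving_swap.comp (volume_preserving_finTwoArrow ℝ)

section CorrMatrix

variable {ρ : ℝ}

theorem det_corrMatrix (ρ : ℝ) : (corrMatrix ρ).det = 1 - ρ ^ 2 := by
  rw [corrMatrix, Matrix.det_fin_two_of]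
  ring

theorem inv_corrMatrix (ρ : ℝ) :
    (corrMatrix ρ)⁻¹ = (1 - ρ ^ 2)⁻¹ • !![1, -ρ; -ρ, 1] := by
  rw [Matrix.inv_def, det_corrMatrix, corrMatrix, Matrix.adjugate_fin_two_of,
    Ring.inverse_eq_inv']

theorem one_sub_sq_pos (hρ₁ : -1 < ρ) (hρ₂ : ρ < 1) : 0 < 1 - ρ ^ 2 := by
  nlinarith

theorem dotProduct_inv_corrMatrix_mulVec (hρ₁ : -1 < ρ) (hρ₂ : ρ < 1) (x : Fin 2 → ℝ) (i : Fin 2) :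
    x ⬝ᵥ ((corrMatrix ρ)⁻¹ *ᵥ x) =
      x i ^ 2 + (x (i + 1) - ρ * x i) ^ 2 / (1 - ρ ^ 2) := by
  have hdet := (one_sub_sq_pos hρ₁ hρ₂).ne'
  rw [inv_corrMatrix]
  fin_cases i <;> simp [dotProduct, Matrix.mulVec, Fin.sum_univ_two] <;> field_simp <;> ring

theorem posSemidef_inv_corrMatrix (hρ₁ : -1 < ρ) (hρ₂ : ρ < 1) :
    ((corrMatrix ρ)⁻¹).PosSemidef := by
  refine .of_dotProduct_mulVec_nonneg ?_ fun x => ?_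
  · rw [Matrix.isHermitian_iff_isSymm, inv_corrMatrix, Matrix.IsSymm.ext_iff]
    simp [Fin.forall_fin_two]
  · have hdet := one_sub_sq_pos hρ₁ hρ₂
    rw [star_trivial, dotProduct_inv_corrMatrix_mulVec hρ₁ hρ₂ x 0]
    positivity

theorem inv_corrMatrix_mulVec_one (hρ₁ : -1 < ρ) (hρ₂ : ρ < 1) (i : Fin 2) :
    ((corrMatrix ρ)⁻¹ *ᵥ 1) i = (1 + ρ)⁻¹ := by
  have hdet := (one_sub_sq_pos hρ₁ hρ₂).ne'
  have hρ : 1 + ρ ≠ 0 := by linarith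
  rw [inv_corrMatrix]
  fin_cases i <;> simp [Matrix.mulVec, dotProduct, Fin.sum_univ_two] <;> field_simp <;> ring

theorem normalPDF₂_corrMatrix_eq_mul (hρ₁ : -1 < ρ) (hρ₂ : ρ < 1) (x : Fin 2 → ℝ) (i : Fin 2) :
    normalPDF₂ (corrMatrix ρ) x =
      gaussianPDFReal 0 1 (x i) *
        gaussianPDFReal (ρ * x i) (1 - ρ ^ 2).toNNReal (x (i + 1)) := by
  have hdet := one_sub_sq_pos hρ₁ hρ₂
  have hsqrt : √(2 * Real.pi * (1 - ρ ^ 2)) * √(2 * Real.pi) = 2 * Real.pi * √(1 - ρ ^ 2) := by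
    rw [Real.sqrt_mul (by positivity), mul_right_comm, Real.mul_self_sqrt (by positivity)]
  rw [normalPDF₂, dotProduct_inv_corrMatrix_mulVec hρ₁ hρ₂ x i, det_corrMatrix,
    gaussianPDFReal_zero_one, gaussianPDFReal, Real.coe_toNNReal _ hdet.le, ← hsqrt]
  have hexp : Real.exp (-(x i ^ 2 + (x (i + 1) - ρ * x i) ^ 2 / (1 - ρ ^ 2)) / 2) =
      Real.exp (-x i ^ 2 / 2) * Real.exp (-(x (i + 1) - ρ * x i) ^ 2 / (2 * (1 - ρ ^ 2))) := by
    rw [← Real.exp_add]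
    congr 1
    field_simp
    ring
  rw [hexp, mul_inv]
  ring

end CorrMatrix

section Marginals

variable {ρ : ℝ}

/-- The density `2 φ(x) Φ(l x)` of the univariate skew normal distribution with skewness `l`. -/
noncomputable def skewNormalPDF (l x : ℝ) : ℝ := 2 * gaussianPDFReal 0 1 x * stdNormalCDF (l * x)

/-- The skewness of the `i`-th marginal of `SN₂(θ, corrMatrix ρ)`; the other index is `i + 1`. -/
noncomputable def marginalSkewness (θ : Fin 2 → ℝ) (ρ : ℝ) (i : Fin 2) : ℝ :=
  (θ i + ρ * θ (i + 1)) / √(1 + θ (i + 1) ^ 2 * (1 - ρ ^ 2))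

theorem marginalSkewness_const (θ ρ : ℝ) (i : Fin 2) :
    marginalSkewness ![θ, θ] ρ i = lam θ ρ := by
  fin_cases i <;> simp [marginalSkewness, lam] <;> ring

theorem skewNormalPDF_nonneg (l : ℝ) : 0 ≤ skewNormalPDF l := fun x =>
  mul_nonneg (mul_nonneg zero_le_two (gaussianPDFReal_nonneg _ _ x)) (stdNormalCDF_nonneg _)

theorem measurable_skewNormalPDF (l : ℝ) : Measurable (skewNormalPDF l) := by
  unfold skewNormalPDF
  fun_prop

theorem skewNormalPDF₂_nonneg (θ : Fin 2 → ℝ) (R : Matrix (Fin 2) (Fin 2) ℝ) :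
    0 ≤ skewNormalPDF₂ θ R := fun x =>
  mul_nonneg (mul_nonneg zero_le_two (by rw [normalPDF₂]; positivity)) (stdNormalCDF_nonneg _)

theorem measurable_skewNormalPDF₂ (θ : Fin 2 → ℝ) (R : Matrix (Fin 2) (Fin 2) ℝ) :
    Measurable (skewNormalPDF₂ θ R) := by
  unfold skewNormalPDF₂ normalPDF₂
  fun_prop

theorem lintegral_gaussianPDFReal_mul_stdNormalCDF (a b μ : ℝ) {v : NNReal} (hv : v ≠ 0) :
    ∫⁻ y, ENNReal.ofReal (gaussianPDFReal μ v y * stdNormalCDF (a + b * y)) =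
      ENNReal.ofReal (stdNormalCDF ((a + b * μ) / √(1 + b ^ 2 * v))) := by
  rw [← lintegral_stdNormalCDF_gaussianReal, gaussianReal_of_var_ne_zero _ hv,
    lintegral_withDensity_eq_lintegral_mul _ (by fun_prop) (by fun_prop)]
  simp only [Pi.mul_apply, gaussianPDF, ENNReal.ofReal_mul (gaussianPDFReal_nonneg μ v _)]

theorem map_eval_skewNormal₂ (hρ₁ : -1 < ρ) (hρ₂ : ρ < 1) (θ : Fin 2 → ℝ) (i : Fin 2) :
    (skewNormal₂ θ (corrMatrix ρ)).map (fun x => x i) =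
      volume.withDensity fun x => ENNReal.ofReal (skewNormalPDF (marginalSkewness θ ρ i) x) := by
  have hdet := one_sub_sq_pos hρ₁ hρ₂
  set v := (1 - ρ ^ 2).toNNReal
  have hv : v ≠ 0 := (Real.toNNReal_pos.2 hdet).ne'
  set g : ℝ × ℝ → ENNReal := fun p => ENNReal.ofReal (2 * gaussianPDFReal 0 1 p.1) *
    ENNReal.ofReal (gaussianPDFReal (ρ * p.1) v p.2 *
      stdNormalCDF (θ i * p.1 + θ (i + 1) * p.2)) with hg
  have hgm : Measurable g := by
    simp only [hg, gaussianPDFReal]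
    fun_prop
  have hnonneg : ∀ x, 0 ≤ 2 * gaussianPDFReal 0 1 x := fun x =>
    mul_nonneg zero_le_two (gaussianPDFReal_nonneg _ _ x)
  have hdensity : (fun x => ENNReal.ofReal (skewNormalPDF₂ θ (corrMatrix ρ) x)) =
      g ∘ fun x => (x i, x (i + 1)) := by
    ext x
    have hdot : θ ⬝ᵥ x = θ i * x i + θ (i + 1) * x (i + 1) := by
      fin_cases i <;> simp [dotProduct, Fin.sum_univ_two, add_comm]
    simp only [Function.comp_apply, hg]
    rw [← ENNReal.ofReal_mul (hnonneg _), skewNormalPDF₂, hdot,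
      normalPDF₂_corrMatrix_eq_mul hρ₁ hρ₂ x i]
    congr 1
    ring
  rw [skewNormal₂, hdensity, map_fst_withDensity_comp (volume_preserving_pair i) hgm]
  congr 1
  ext x
  simp only [hg]
  rw [lintegral_const_mul _ (by fun_prop), lintegral_gaussianPDFReal_mul_stdNormalCDF _ _ _ hv,
    ← ENNReal.ofReal_mul (hnonneg x), Real.coe_toNNReal _ hdet.le, skewNormalPDF,
    marginalSkewness]
  congr 3
  ring

end Marginals

section Quantile

variable (ν : Measure ℝ) [IsProbabilityMeasure ν] [NullSingletonClass ν]

theorem continuous_cdf : Continuous (cdf ν) := by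
  refine continuous_iff_continuousAt.2 fun x => ?_
  rw [(monotone_cdf ν).continuousAt_iff_leftLim_eq_rightLim, StieltjesFunction.rightLim_eq]
  have hjump := (cdf ν).measure_singleton x
  rw [measure_cdf, measure_singleton, eq_comm, ENNReal.ofReal_eq_zero, sub_nonpos] at hjump
  exact le_antisymm ((monotone_cdf ν).leftLim_le le_rfl) hjump

theorem cdf_sInf_eq {u : ℝ} (hu : u ∈ Set.Ioo (0 : ℝ) 1) :
    cdf ν (sInf {x | u ≤ cdf ν x}) = u := by
  have hc := continuous_cdf ν
  set S := {x | u ≤ cdf ν x}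
  have hne : S.Nonempty := ((tendsto_cdf_atTop ν).eventually_const_le hu.2).exists
  have hbdd : BddBelow S := by
    obtain ⟨x, hx⟩ := ((tendsto_cdf_atBot ν).eventually_lt_const hu.1).exists
    exact ⟨x, fun y hy => ((monotone_cdf ν).reflect_lt (hx.trans_le hy)).le⟩
  refine le_antisymm ?_ ((isClosed_le continuous_const hc).csInf_mem hne hbdd)
  refine le_of_tendsto (hc.continuousAt.mono_left (nhdsWithin_le_nhds (s := Set.Iio (sInf S)))) ?_
  filter_upwards [self_mem_nhdsWithin] with x hx
  exact (not_le.1 fun hxS : x ∈ S => notMem_of_lt_csInf hx hbdd hxS).le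

end Quantile

section TailDependence

variable {Ω : Type*} [MeasurableSpace Ω] {P : Measure Ω} {X : Ω → Fin 2 → ℝ}

/-- The joint distribution function `P(X₁ ≤ s, X₂ ≤ s)` of `X` on the diagonal; when the marginals
agree, the copula satisfies `C(u, u) = diagonalCDF P X (F₁⁻¹(u))`. -/
noncomputable def diagonalCDF (P : Measure Ω) (X : Ω → Fin 2 → ℝ) (s : ℝ) : ℝ :=
  P.real {ω | X ω 0 ≤ s ∧ X ω 1 ≤ s}

variable [IsProbabilityMeasure P]

theorem marginalCDF_eq_cdf (hX : AEMeasurable X P) (i : Fin 2) :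
    marginalCDF P X i = cdf (P.map fun ω => X ω i) := by
  have hXi : AEMeasurable (fun ω => X ω i) P := hX.eval i
  have := Measure.isProbabilityMeasure_map hXi
  ext x
  rw [cdf_eq_real, map_measureReal_apply_of_aemeasurable hXi measurableSet_Iic]
  rfl

theorem monotone_marginalCDF (i : Fin 2) : Monotone (marginalCDF P X i) := fun _ _ hab =>
  measureReal_mono fun _ hω => hω.trans hab

theorem marginalCDF_quantile (hX : AEMeasurable X P) {i : Fin 2}
    (hXi : NullSingletonClass (P.map fun ω => X ω i)) {u : ℝ} (hu : u ∈ Set.Ioo (0 : ℝ) 1) :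
    marginalCDF P X i (quantile P X i u) = u := by
  have := Measure.isProbabilityMeasure_map (hX.eval i)
  rw [quantile, marginalCDF_eq_cdf hX]
  exact cdf_sInf_eq _ hu

theorem tendsto_quantile_atBot (hX : AEMeasurable X P) {i : Fin 2}
    (hXi : NullSingletonClass (P.map fun ω => X ω i)) (hpos : ∀ x, 0 < marginalCDF P X i x) :
    Tendsto (quantile P X i) (𝓝[>] 0) atBot := by
  refine tendsto_atBot.2 fun b => ?_
  filter_upwards [Ioo_mem_nhdsGT (hpos b), Ioo_mem_nhdsGT zero_lt_one] with u hub hu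
  rw [← marginalCDF_quantile hX hXi hu] at hub
  exact ((monotone_marginalCDF i).reflect_lt hub.2).le

theorem lowerTailDependence_eq_copula_div (hX : AEMeasurable X P)
    (hX₁ : NullSingletonClass (P.map fun ω => X ω 1)) {u : ℝ} (hu : u ∈ Set.Ioo (0 : ℝ) 1) :
    lowerTailDependence P X u = copula P X u u / u := by
  have hnull : NullMeasurableSet {ω | X ω 1 ≤ quantile P X 1 u} P :=
    (hX.eval 1).nullMeasurableSet_preimage measurableSet_Iic
  have hcond : P.real {ω | X ω 1 ≤ quantile P X 1 u} = u := marginalCDF_quantile hX hX₁ hu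
  rw [lowerTailDependence, ProbabilityTheory.cond, measureReal_ennreal_smul_apply,
    ENNReal.toReal_inv, ← measureReal_def, hcond, measureReal_def,
    Measure.restrict_apply₀' hnull, copula, div_eq_inv_mul]
  rfl

theorem lowerTailDependence_isEquivalent {c d p q a b : ℝ} (hX : AEMeasurable X P)
    (hnull : ∀ i, NullSingletonClass (P.map fun ω => X ω i))
    (heq : marginalCDF P X 1 = marginalCDF P X 0) (hc : 0 < c) (hd : d ≠ 0) (ha : 0 < a)
    (hmarginal : HasGaussianTail (marginalCDF P X 0) c p a)
    (hjoint : HasGaussianTail (diagonalCDF P X) d q b) :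
    lowerTailDependence P X ~[𝓝[>] 0] fun u =>
      d * c ^ (-(b / a)) * a ^ (-((p * (b / a) - q) / 2)) * u ^ (b / a - 1) *
        (-Real.log u) ^ ((p * (b / a) - q) / 2) := by
  have hpos : ∀ x, 0 < marginalCDF P X 0 x := fun x => by
    obtain ⟨t, ht, hxt⟩ := ((hmarginal.eventually_pos hc).and (eventually_ge_atTop (-x))).exists
    exact ht.trans_le (monotone_marginalCDF 0 (neg_le.1 hxt))
  have hquantile : Tendsto (fun u => -quantile P X 0 u) (𝓝[>] 0) atTop :=
    tendsto_neg_atBot_atTop.comp (tendsto_quantile_atBot hX (hnull 0) hpos)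
  have htails := (hmarginal.isEquivalent_rpow_mul_neg_log_rpow hjoint hc hd ha).comp_tendsto
    hquantile
  have hu : ∀ᶠ u : ℝ in 𝓝[>] 0, u ∈ Set.Ioo (0 : ℝ) 1 := Ioo_mem_nhdsGT zero_lt_one
  refine ((htails.div (IsEquivalent.refl (u := id))).congr_left ?_).congr_right ?_
  · filter_upwards [hu] with u hu
    have hq : quantile P X 1 u = quantile P X 0 u := by rw [quantile, heq, quantile]
    simp only [Pi.div_apply, Function.comp_apply, neg_neg, id_eq,
      lowerTailDependence_eq_copula_div hX (hnull 1) hu, copula,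
      diagonalCDF, hq]
  · filter_upwards [hu] with u hu
    have hlog : 0 ≤ -Real.log u := neg_nonneg.2 (Real.log_nonpos hu.1.le hu.2.le)
    simp only [Pi.div_apply, Function.comp_apply, neg_neg, id_eq,
      marginalCDF_quantile hX (hnull 0) hu, Real.div_rpow hu.1.le hc.le, Real.div_rpow hlog ha.le,
      Real.rpow_neg hc.le, Real.rpow_neg ha.le, Real.rpow_sub_one hu.1.ne']
    ring

end TailDependence

section SkewNormalTails

variable {Ω : Type*} [MeasurableSpace Ω] {P : Measure Ω} {X : Ω → Fin 2 → ℝ} {ρ : ℝ}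

theorem map_eval_eq_withDensity (hρ₁ : -1 < ρ) (hρ₂ : ρ < 1) {θ : Fin 2 → ℝ}
    (hX : HasLaw X (skewNormal₂ θ (corrMatrix ρ)) P) (i : Fin 2) :
    P.map (fun ω => X ω i) =
      volume.withDensity fun x => ENNReal.ofReal (skewNormalPDF (marginalSkewness θ ρ i) x) := by
  rw [← map_eval_skewNormal₂ hρ₁ hρ₂, ← hX.map_eq,
    AEMeasurable.map_map_of_aemeasurable (measurable_pi_apply i).aemeasurable
      hX.aemeasurable]
  rfl

theorem nullSingletonClass_map_eval (hρ₁ : -1 < ρ) (hρ₂ : ρ < 1) {θ : Fin 2 → ℝ}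
    (hX : HasLaw X (skewNormal₂ θ (corrMatrix ρ)) P) (i : Fin 2) :
    NullSingletonClass (P.map fun ω => X ω i) := by
  rw [map_eval_eq_withDensity hρ₁ hρ₂ hX]
  infer_instance

theorem marginalCDF_eq_setIntegral (hρ₁ : -1 < ρ) (hρ₂ : ρ < 1) {θ : Fin 2 → ℝ}
    (hX : HasLaw X (skewNormal₂ θ (corrMatrix ρ)) P) (i : Fin 2) :
    marginalCDF P X i = fun s =>
      ∫ x in Set.Iic s, skewNormalPDF (marginalSkewness θ ρ i) x := by
  ext s
  rw [← real_withDensity_ofReal (measurable_skewNormalPDF _) (skewNormalPDF_nonneg _)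
    measurableSet_Iic, ← map_eval_eq_withDensity hρ₁ hρ₂ hX,
    map_measureReal_apply_of_aemeasurable (hX.aemeasurable.eval i) measurableSet_Iic]
  rfl

theorem marginalCDF_one_eq_zero (hρ₁ : -1 < ρ) (hρ₂ : ρ < 1) {θ : ℝ}
    (hX : HasLaw X (skewNormal₂ ![θ, θ] (corrMatrix ρ)) P) :
    marginalCDF P X 1 = marginalCDF P X 0 := by
  simp only [marginalCDF_eq_setIntegral hρ₁ hρ₂ hX, marginalSkewness_const]

theorem hasGaussianTail_marginalCDF (hρ₁ : -1 < ρ) (hρ₂ : ρ < 1) {θ : Fin 2 → ℝ}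
    (hX : HasLaw X (skewNormal₂ θ (corrMatrix ρ)) P) (i : Fin 2) {c p a : ℝ} (hp : 0 ≤ p)
    (ha : 0 ≤ a)
    (hΦ : HasGaussianTail (fun s => stdNormalCDF (marginalSkewness θ ρ i * s)) c p a) :
    HasGaussianTail (marginalCDF P X i) (2 * (√(2 * Real.pi))⁻¹ * (c / (1 + 2 * a))) (p + 1)
      (1 / 2 + a) := by
  have h := (hΦ.setIntegral_Iic (by fun_prop) hp ha).const_mul (2 * (√(2 * Real.pi))⁻¹)
  simpa only [marginalCDF_eq_setIntegral hρ₁ hρ₂ hX, skewNormalPDF, gaussianPDFReal_zero_one,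
    ← integral_const_mul, mul_assoc] using h

theorem diagonalCDF_eq_setIntegral {θ : Fin 2 → ℝ} {R : Matrix (Fin 2) (Fin 2) ℝ}
    (hX : HasLaw X (skewNormal₂ θ R) P) (s : ℝ) :
    diagonalCDF P X s = ∫ x in Set.Iic (s • 1), skewNormalPDF₂ θ R x := by
  have hset : {ω | X ω 0 ≤ s ∧ X ω 1 ≤ s} = X ⁻¹' Set.Iic (s • 1) := by
    ext ω
    simp [Pi.le_def, Fin.forall_fin_two]
  rw [← real_withDensity_ofReal (measurable_skewNormalPDF₂ θ R) (skewNormalPDF₂_nonneg θ R)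
    measurableSet_Iic, ← skewNormal₂, ← hX.map_eq,
    map_measureReal_apply_of_aemeasurable hX.aemeasurable measurableSet_Iic, diagonalCDF, hset]

theorem hasGaussianTail_diagonalCDF (hρ₁ : -1 < ρ) (hρ₂ : ρ < 1) {θ : ℝ}
    (hX : HasLaw X (skewNormal₂ ![θ, θ] (corrMatrix ρ)) P) {c p a : ℝ} (hp : 0 ≤ p) (ha : 0 ≤ a)
    (hΦ : HasGaussianTail (fun s => stdNormalCDF (2 * θ * s)) c p a) :
    HasGaussianTail (diagonalCDF P X)
      ((Real.pi * √(1 - ρ ^ 2))⁻¹ * (c * (((1 + ρ)⁻¹ + a) ^ 2)⁻¹)) (p + 2)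
      ((1 + ρ)⁻¹ + a) := by
  have hmulVec := inv_corrMatrix_mulVec_one hρ₁ hρ₂
  have hpos : 0 < (1 + ρ)⁻¹ := inv_pos.2 (by linarith)
  have hquad : (1 : Fin 2 → ℝ) ⬝ᵥ ((corrMatrix ρ)⁻¹ *ᵥ 1) / 2 = (1 + ρ)⁻¹ := by
    simp only [one_dotProduct, Fin.sum_univ_two, hmulVec]
    ring
  have hdot : ∀ x : Fin 2 → ℝ, ![θ, θ] ⬝ᵥ x = 2 * θ * ((fun _ => 1 / 2) ⬝ᵥ x) := fun x => by
    simp [dotProduct, Fin.sum_univ_two]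
    ring
  have h := (hΦ.setIntegral_Iic_smul (A := (corrMatrix ρ)⁻¹) (e := 1) (w := fun _ => 1 / 2)
    (by fun_prop) hp ha (posSemidef_inv_corrMatrix hρ₁ hρ₂) (fun i => (hmulVec i).symm ▸ hpos)
    (fun _ => by positivity) (by simp [dotProduct])).const_mul (Real.pi * √(1 - ρ ^ 2))⁻¹
  simp only [hquad, hmulVec, ← hdot, ← integral_const_mul, Fin.prod_univ_two, Fintype.card_fin,
    Nat.cast_ofNat] at h
  convert h using 1
  · ext s
    simp only [diagonalCDF_eq_setIntegral hX, skewNormalPDF₂, normalPDF₂, det_corrMatrix]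
    congr 1
    ext x
    field_simp
  · congr 1
    field_simp

end SkewNormalTails

section Constants

variable {θ ρ : ℝ}

theorem lam_pos (hρ₁ : -1 < ρ) (hρ₂ : ρ < 1) (hθ : 0 < θ) : 0 < lam θ ρ := by
  have hdet := one_sub_sq_pos hρ₁ hρ₂
  have hρ : 0 < 1 + ρ := by linarith
  rw [lam]
  positivity

theorem lam_neg (hρ₁ : -1 < ρ) (hρ₂ : ρ < 1) (hθ : θ < 0) : lam θ ρ < 0 := by
  have hdet := one_sub_sq_pos hρ₁ hρ₂
  have hρ : 0 < 1 + ρ := by linarith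
  exact div_neg_of_neg_of_pos (mul_neg_of_neg_of_pos hθ hρ) (by positivity)

theorem alpha_pos (hρ₁ : -1 < ρ) (hθ : 0 < θ) : 0 < alpha θ ρ := by
  have hρ : 0 < 1 + ρ := by linarith
  rw [alpha]
  positivity

theorem beta_pos (hρ₁ : -1 < ρ) (hρ₂ : ρ < 1) : 0 < beta θ ρ := by
  have hρ : 0 < 1 + ρ := by linarith
  have := sub_pos.2 hρ₂
  rw [beta]
  positivity

theorem lam_sq (hρ₁ : -1 < ρ) (hρ₂ : ρ < 1) :
    lam θ ρ ^ 2 = θ ^ 2 * (1 + ρ) ^ 2 / (1 + θ ^ 2 * (1 - ρ ^ 2)) := by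
  have hdet := one_sub_sq_pos hρ₁ hρ₂
  rw [lam, div_pow, Real.sq_sqrt (by positivity), mul_pow]

theorem alpha_sq (hρ₁ : -1 < ρ) :
    alpha θ ρ ^ 2 = θ ^ 2 * (1 + ρ) ^ 2 / (1 + 2 * θ ^ 2 * (1 + ρ)) := by
  have hρ : 0 < 1 + ρ := by linarith
  rw [alpha, div_pow, Real.sq_sqrt (by positivity), mul_pow]

theorem beta_sq (hρ₁ : -1 < ρ) (hρ₂ : ρ < 1) :
    beta θ ρ ^ 2 = (1 - ρ) * (1 + 2 * θ ^ 2 * (1 + ρ)) / (1 + ρ) := by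
  have hρ : 0 < 1 + ρ := by linarith
  have := sub_pos.2 hρ₂
  exact Real.sq_sqrt (by positivity)

theorem alpha_mul_beta (hρ₁ : -1 < ρ) : alpha θ ρ * beta θ ρ = θ * √(1 - ρ ^ 2) := by
  have hρ : 0 < 1 + ρ := by linarith
  have hD : 0 < 1 + 2 * θ ^ 2 * (1 + ρ) := by positivity
  have hbeta : beta θ ρ = √(1 - ρ ^ 2) * √(1 + 2 * θ ^ 2 * (1 + ρ)) / (1 + ρ) := by
    rw [beta, ← Real.sqrt_mul' _ hD.le, ← Real.sqrt_sq hρ.le, ← Real.sqrt_div' _ (sq_nonneg _),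
      Real.sqrt_sq hρ.le]
    congr 1
    field_simp
    ring
  rw [hbeta, alpha]
  field_simp

theorem lam_sq_mul_one_add_beta_sq (hρ₁ : -1 < ρ) (hρ₂ : ρ < 1) :
    lam θ ρ ^ 2 * (1 + beta θ ρ ^ 2) = 2 * alpha θ ρ ^ 2 * ((1 + ρ)⁻¹ + 2 * θ ^ 2) := by
  have hdet := one_sub_sq_pos hρ₁ hρ₂
  have hρ : 0 < 1 + ρ := by linarith
  rw [lam_sq hρ₁ hρ₂, alpha_sq hρ₁, beta_sq hρ₁ hρ₂]
  field_simp
  ring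

theorem one_add_lam_sq_mul_one_add_beta_sq (hρ₁ : -1 < ρ) (hρ₂ : ρ < 1) :
    (1 + lam θ ρ ^ 2) / 2 * (1 + beta θ ρ ^ 2) = (1 + ρ)⁻¹ + 2 * θ ^ 2 := by
  have hdet := one_sub_sq_pos hρ₁ hρ₂
  have hρ : 0 < 1 + ρ := by linarith
  rw [lam_sq hρ₁ hρ₂, beta_sq hρ₁ hρ₂]
  field_simp
  ring

theorem two_mul_inv_sqrt_two_mul_pi : 2 * (√(2 * Real.pi))⁻¹ = √(2 / Real.pi) := by
  rw [Real.sqrt_mul zero_le_two, Real.sqrt_div zero_le_two, mul_inv, ← mul_assoc,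
    ← div_eq_mul_inv 2, Real.div_sqrt, div_eq_mul_inv]

theorem sqrt_two_div_pi_rpow (r : ℝ) :
    √(2 / Real.pi) ^ (-(2 * (1 + r))) = Real.pi / 2 * (Real.pi / 2) ^ r := by
  have hhalf : 1 / 2 * -(2 * (1 + r)) = -(1 + r) := by ring
  rw [Real.sqrt_eq_rpow, ← Real.rpow_mul (by positivity), hhalf, Real.rpow_neg (by positivity),
    ← Real.inv_rpow (by positivity), inv_div, Real.rpow_add (by positivity), Real.rpow_one]

theorem inv_pi_mul_sqrt_one_sub_sq_mul (hρ₁ : -1 < ρ) (hρ₂ : ρ < 1) :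
    (Real.pi * √(1 - ρ ^ 2))⁻¹ * (1 + ρ) ^ 2 * (Real.pi / 2) =
      (1 + ρ) / 2 * √((1 + ρ) / (1 - ρ)) := by
  have hdet := one_sub_sq_pos hρ₁ hρ₂
  have hρ : 0 < 1 + ρ := by linarith
  have hρ' : 0 < 1 - ρ := by linarith
  have hsq : (1 + ρ) / (1 - ρ) = (1 + ρ) ^ 2 / (1 - ρ ^ 2) := by
    field_simp
    ring
  rw [hsq, Real.sqrt_div (sq_nonneg _), Real.sqrt_sq hρ.le]
  field_simp

end Constants

section Asymptotics

variable {Ω : Type*} [MeasurableSpace Ω] {P : Measure Ω} {X : Ω → Fin 2 → ℝ} {θ ρ : ℝ}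

theorem hasGaussianTail_marginalCDF_of_pos (hρ₁ : -1 < ρ) (hρ₂ : ρ < 1)
    (hX : HasLaw X (skewNormal₂ ![θ, θ] (corrMatrix ρ)) P) (hθ : 0 < θ) (i : Fin 2) :
    HasGaussianTail (marginalCDF P X i) (Real.pi * lam θ ρ * (1 + lam θ ρ ^ 2))⁻¹ 2
      ((1 + lam θ ρ ^ 2) / 2) := by
  have hlam := lam_pos hρ₁ hρ₂ hθ
  have hΦ := hasGaussianTail_stdNormalCDF_mul_of_pos hlam
  rw [← marginalSkewness_const θ ρ i] at hΦ
  convert hasGaussianTail_marginalCDF hρ₁ hρ₂ hX i zero_le_one (by positivity) hΦ using 1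
  · have hsqrt : (√(2 * Real.pi))⁻¹ ^ 2 = (2 * Real.pi)⁻¹ := by
      rw [inv_pow, Real.sq_sqrt (by positivity)]
    calc (Real.pi * lam θ ρ * (1 + lam θ ρ ^ 2))⁻¹
        = 2 * (2 * Real.pi)⁻¹ * (lam θ ρ)⁻¹ / (1 + lam θ ρ ^ 2) := by field_simp
      _ = _ := by
        rw [marginalSkewness_const, ← hsqrt]
        ring
  · norm_num
  · rw [marginalSkewness_const, add_div]

theorem hasGaussianTail_marginalCDF_of_neg (hρ₁ : -1 < ρ) (hρ₂ : ρ < 1)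
    (hX : HasLaw X (skewNormal₂ ![θ, θ] (corrMatrix ρ)) P) (hθ : θ < 0) (i : Fin 2) :
    HasGaussianTail (marginalCDF P X i) √(2 / Real.pi) 1 (1 / 2) := by
  have hΦ := hasGaussianTail_stdNormalCDF_mul_of_neg (lam_neg hρ₁ hρ₂ hθ)
  rw [← marginalSkewness_const θ ρ i] at hΦ
  have h := hasGaussianTail_marginalCDF hρ₁ hρ₂ hX i le_rfl le_rfl hΦ
  rw [two_mul_inv_sqrt_two_mul_pi] at h
  simpa only [mul_zero, add_zero, zero_add, div_one, mul_one] using h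

theorem hasGaussianTail_diagonalCDF_of_pos (hρ₁ : -1 < ρ) (hρ₂ : ρ < 1)
    (hX : HasLaw X (skewNormal₂ ![θ, θ] (corrMatrix ρ)) P) (hθ : 0 < θ) :
    HasGaussianTail (diagonalCDF P X)
      (alpha θ ρ ^ 3 / (Real.pi * lam θ ρ ^ 4 * beta θ ρ * (1 + beta θ ρ ^ 2) ^ 2) *
        √(2 / Real.pi)) 3 ((1 + lam θ ρ ^ 2) / 2 * (1 + beta θ ρ ^ 2)) := by
  have hα := alpha_pos hρ₁ hθ
  have hβ : 0 < beta θ ρ := beta_pos hρ₁ hρ₂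
  have hlam := lam_pos hρ₁ hρ₂ hθ
  have hrate : (1 + ρ)⁻¹ + (2 * θ) ^ 2 / 2 = (1 + ρ)⁻¹ + 2 * θ ^ 2 := by ring
  have hsqrt : √(1 - ρ ^ 2) = alpha θ ρ * beta θ ρ / θ := by
    rw [alpha_mul_beta hρ₁, mul_div_cancel_left₀ _ hθ.ne']
  have hrate' : (1 + ρ)⁻¹ + 2 * θ ^ 2 =
      lam θ ρ ^ 2 * (1 + beta θ ρ ^ 2) / (2 * alpha θ ρ ^ 2) := by
    rw [lam_sq_mul_one_add_beta_sq hρ₁ hρ₂, mul_div_cancel_left₀ _ (by positivity)]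
  convert hasGaussianTail_diagonalCDF hρ₁ hρ₂ hX zero_le_one (by positivity)
    (hasGaussianTail_stdNormalCDF_mul_of_pos (mul_pos two_pos hθ)) using 1
  · rw [hrate, hrate', hsqrt, ← two_mul_inv_sqrt_two_mul_pi]
    field_simp
  · norm_num
  · rw [hrate, one_add_lam_sq_mul_one_add_beta_sq hρ₁ hρ₂]

theorem hasGaussianTail_diagonalCDF_of_neg (hρ₁ : -1 < ρ) (hρ₂ : ρ < 1)
    (hX : HasLaw X (skewNormal₂ ![θ, θ] (corrMatrix ρ)) P) (hθ : θ < 0) :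
    HasGaussianTail (diagonalCDF P X)
      ((Real.pi * √(1 - ρ ^ 2))⁻¹ * (1 + ρ) ^ 2) 2 (1 + ρ)⁻¹ := by
  simpa using hasGaussianTail_diagonalCDF hρ₁ hρ₂ hX le_rfl le_rfl
    (hasGaussianTail_stdNormalCDF_mul_of_neg (mul_neg_of_pos_of_neg two_pos hθ))

variable [IsProbabilityMeasure P]

theorem lowerTailDependence_isEquivalent_of_pos (hρ₁ : -1 < ρ) (hρ₂ : ρ < 1)
    (hX : HasLaw X (skewNormal₂ ![θ, θ] (corrMatrix ρ)) P) (hθ : 0 < θ) :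
    lowerTailDependence P X ~[𝓝[>] 0] fun u : ℝ =>
      u ^ (beta θ ρ ^ 2) *
        (alpha θ ρ ^ 3 / (Real.pi * lam θ ρ ^ 4 * beta θ ρ * (1 + beta θ ρ ^ 2) ^ 2)) *
        √(2 / Real.pi) * (2 * Real.pi * lam θ ρ) ^ (1 + beta θ ρ ^ 2) *
        ((1 + lam θ ρ ^ 2) / 2) ^ (3 / 2 : ℝ) * (-Real.log u) ^ (beta θ ρ ^ 2 - 1 / 2) := by
  have hα := alpha_pos hρ₁ hθ
  have hβ : 0 < beta θ ρ := beta_pos hρ₁ hρ₂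
  have hlam := lam_pos hρ₁ hρ₂ hθ
  have h := lowerTailDependence_isEquivalent hX.aemeasurable
    (nullSingletonClass_map_eval hρ₁ hρ₂ hX) (marginalCDF_one_eq_zero hρ₁ hρ₂ hX)
    (by positivity) (by positivity) (by positivity)
    (hasGaussianTail_marginalCDF_of_pos hρ₁ hρ₂ hX hθ 0)
    (hasGaussianTail_diagonalCDF_of_pos hρ₁ hρ₂ hX hθ)
  refine h.congr_right (.of_forall fun u => ?_)
  set a := (1 + lam θ ρ ^ 2) / 2 with ha
  set B := beta θ ρ ^ 2
  have ha₀ : 0 < a := by positivity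
  have hratio : a * (1 + B) / a = 1 + B := mul_div_cancel_left₀ _ ha₀.ne'
  have hscale : (Real.pi * lam θ ρ * (1 + lam θ ρ ^ 2))⁻¹ = (2 * Real.pi * lam θ ρ * a)⁻¹ := by
    rw [ha]
    ring
  have hexp : (2 * (1 + B) - 3) / 2 = B - 1 / 2 := by ring
  have hpow : a ^ (3 / 2 : ℝ) = a ^ (1 + B) * a ^ (-(B - 1 / 2)) := by
    rw [← Real.rpow_add ha₀]
    congr 1
    ring
  simp only [hratio, hscale, hexp, hpow, add_sub_cancel_left]
  rw [Real.inv_rpow (by positivity), ← Real.rpow_neg (by positivity), neg_neg,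
    Real.mul_rpow (by positivity) ha₀.le]
  ring

theorem lowerTailDependence_isEquivalent_of_neg (hρ₁ : -1 < ρ) (hρ₂ : ρ < 1)
    (hX : HasLaw X (skewNormal₂ ![θ, θ] (corrMatrix ρ)) P) (hθ : θ < 0) :
    lowerTailDependence P X ~[𝓝[>] 0] fun u : ℝ =>
      u ^ ((1 - ρ) / (1 + ρ)) * ((1 + ρ) / 2) * √((1 + ρ) / (1 - ρ)) *
        (-Real.pi * Real.log u) ^ (-ρ / (1 + ρ)) := by
  have hρ : 0 < 1 + ρ := by linarith
  have hdet := one_sub_sq_pos hρ₁ hρ₂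
  have h := lowerTailDependence_isEquivalent hX.aemeasurable
    (nullSingletonClass_map_eval hρ₁ hρ₂ hX) (marginalCDF_one_eq_zero hρ₁ hρ₂ hX)
    (by positivity) (by positivity) one_half_pos
    (hasGaussianTail_marginalCDF_of_neg hρ₁ hρ₂ hX hθ 0)
    (hasGaussianTail_diagonalCDF_of_neg hρ₁ hρ₂ hX hθ)
  refine h.congr_right ?_
  filter_upwards [Ioo_mem_nhdsGT zero_lt_one] with u hu
  have hlog : 0 ≤ -Real.log u := neg_nonneg.2 (Real.log_nonpos hu.1.le hu.2.le)
  set r := -ρ / (1 + ρ) with hr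
  have hratio : (1 + ρ)⁻¹ / (1 / 2) = 2 * (1 + r) := by rw [hr]; field_simp; ring
  have hexp : (1 * (2 * (1 + r)) - 2) / 2 = r := by ring
  have hpow_u : 2 * (1 + r) - 1 = (1 - ρ) / (1 + ρ) := by rw [hr]; field_simp; ring
  have hlog_pow : (Real.pi / 2) ^ r * (1 / 2) ^ (-r) * (-Real.log u) ^ r =
      (-Real.pi * Real.log u) ^ r := by
    rw [one_div, Real.inv_rpow zero_le_two, ← Real.rpow_neg zero_le_two, neg_neg,
      ← Real.mul_rpow (by positivity) zero_le_two, div_mul_cancel₀ _ two_ne_zero,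
      ← Real.mul_rpow Real.pi_pos.le hlog, mul_neg, neg_mul]
  simp only [hratio, sqrt_two_div_pi_rpow, hexp, hpow_u, ← hlog_pow]
  linear_combination (u ^ ((1 - ρ) / (1 + ρ)) * (Real.pi / 2) ^ r * (1 / 2) ^ (-r) *
    (-Real.log u) ^ r) * inv_pi_mul_sqrt_one_sub_sq_mul hρ₁ hρ₂

end Asymptotics

end SkewNormal

theorem theorem2 {Ω : Type*} [MeasurableSpace Ω] (P : Measure Ω) [IsProbabilityMeasure P]
    (X : Ω → Fin 2 → ℝ) (θ ρ : ℝ) (hρ₁ : -1 < ρ) (hρ₂ : ρ < 1)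
    (hX : HasLaw X (SkewNormal.skewNormal₂ ![θ, θ] (SkewNormal.corrMatrix ρ)) P) :
    (∀ u ∈ Set.Ioo (0 : ℝ) 1,
      SkewNormal.lowerTailDependence P X u = SkewNormal.copula P X u u / u) ∧
    (0 < θ →
      SkewNormal.lowerTailDependence P X ~[𝓝[>] 0] fun u : ℝ =>
        u ^ (SkewNormal.beta θ ρ ^ 2) *
          (SkewNormal.alpha θ ρ ^ 3 /
            (Real.pi * SkewNormal.lam θ ρ ^ 4 * SkewNormal.beta θ ρ *
              (1 + SkewNormal.beta θ ρ ^ 2) ^ 2)) *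
          √(2 / Real.pi) *
          (2 * Real.pi * SkewNormal.lam θ ρ) ^ (1 + SkewNormal.beta θ ρ ^ 2) *
          ((1 + SkewNormal.lam θ ρ ^ 2) / 2) ^ (3 / 2 : ℝ) *
          (-Real.log u) ^ (SkewNormal.beta θ ρ ^ 2 - 1 / 2)) ∧
    (θ < 0 →
      SkewNormal.lowerTailDependence P X ~[𝓝[>] 0] fun u : ℝ =>
        u ^ ((1 - ρ) / (1 + ρ)) * ((1 + ρ) / 2) * √((1 + ρ) / (1 - ρ)) *
          (-Real.pi * Real.log u) ^ (-ρ / (1 + ρ))) := by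
  have hnull := SkewNormal.nullSingletonClass_map_eval hρ₁ hρ₂ hX 1
  exact ⟨fun _ => SkewNormal.lowerTailDependence_eq_copula_div hX.aemeasurable hnull,
    SkewNormal.lowerTailDependence_isEquivalent_of_pos hρ₁ hρ₂ hX,
    SkewNormal.lowerTailDependence_isEquivalent_of_neg hρ₁ hρ₂ hX⟩
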